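/- Let $\Theta\subseteq\mathbb R^n$ be open and let $S=\{p_\theta:\theta\in\Theta\}$ be a family of probability distributions on a sample space $\mathcal X$, given by everywhere positive densities $p_\theta(x)$ with respect to a fixed measure, smooth in $\theta$ for each $x$, with $\theta\mapsto p_\theta$ injective; $\theta=(\theta_1,\dots,\theta_n)$ is used as a global coordinate system on $S$. Let $h$ be the Fisher information metric, $h(\partial_i,\partial_j)=-\mathbb E_\theta[\partial_i\partial_j\log p_\theta(x)]$ (the expectations are assumed to exist, and $h$ to be a smooth Riemannian metric on $S$). Let $\nabla$ be an affine connection on $S$ such that $(S,h,\nabla)$ is a statistical manifold, i.e. $\nabla$ is torsion-free and $\nabla h$ is totally symmetric, and assume that $\nabla$ is flat, i.e. its curvature tensor vanishes. Let $\pi:TS\to S$ be the projection and $K:T(TS)\to TS$ the connector of $\nabla$ (characterized by $\nabla_XY=K(Y_*X)$; at $(\theta,u)\in TS$ it is $K(a,b)^k=b^k+\sum_{i,j}\Gamma_{ij}^k(\theta)a^iu^j$, where $\nabla_{\partial_i}\partial_j=\sum_k\Gamma_{ij}^k\partial_k$ and $(a,b)$ denotes $\sum_i a^i\partial_{\theta_i}+\sum_i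 b^i\partial_{\dot\theta_i}$). Identify $A\in T_{u}(TS)$, $u\in T_pS$, with the triple $(u,v,w)=(u,\pi_*A,KA)$, $v,w\in T_pS$. Define on $TS$ $$g((u,v,w),(u,\bar v,\bar w))=h(v,\bar v)+h(w,\bar w),\quad \omega((u,v,w),(u,\bar v,\bar w))=h(v,\bar w)-h(w,\bar v),\quad J(u,v,w)=(u,-w,v).$$ Then $(TS,g,J,\omega)$ is a Kähler manifold: $g$ is a smooth Riemannian metric, $J$ is a smooth almost complex structure ($J^2=-\mathrm{Id}$) with $g(J\cdot,J\cdot)=g$, $\omega=g(J\cdot,\cdot)$ is the smooth fundamental 2-form, $J$ is integrable (around every point of $TS$ there are smooth charts $\varphi$ to open subsets of some $\mathbb C^m$ with $d\varphi\circ J=i\,d\varphi$), and $d\omega=0$. -/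

import Mathlib

open Set MeasureTheory
open scoped ContDiff

noncomputable section

namespace StatKahler

/-! ## Riemannian, almost Hermitian and Kähler structures on an open set -/

section Kahler

variable {V : Type*} [NormedAddCommGroup V] [NormedSpace ℝ V]

/-- `g` is a (smooth) Riemannian metric on the open set `U`; the tangent space at every point
of `U` is `V`. -/
structure IsRiemannianMetricOn (U : Set V) (g : V → V →L[ℝ] V →L[ℝ] ℝ) : Prop where
  smooth : ContDiffOn ℝ ∞ g U
  symm : ∀ x ∈ U, ∀ a b, g x a b = g x b a
  pos : ∀ x ∈ U, ∀ a, a ≠ 0 → 0 < g x a a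

/-- The alternating 2-form `(a, b) ↦ (B a b - B b a) / 2` attached to a bilinear form `B`.
If `B` is itself skew-symmetric, this is `B`, now as an element of Mathlib's type of alternating
forms; see `twoForm_apply_of_skew`. -/
def twoForm (B : V →L[ℝ] V →L[ℝ] ℝ) : V [⋀^Fin 2]→L[ℝ] ℝ :=
  (1 / 2 : ℝ) • ContinuousAlternatingMap.alternatizeUncurryFin
    (((ContinuousAlternatingMap.ofSubsingletonLIE (𝕜 := ℝ) (E := V) (F := ℝ)
      (0 : Fin 1)).toContinuousLinearEquiv : (V →L[ℝ] ℝ) →L[ℝ] (V [⋀^Fin 1]→L[ℝ] ℝ)).comp B)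

theorem twoForm_apply (B : V →L[ℝ] V →L[ℝ] ℝ) (a b : V) :
    twoForm B ![a, b] = (B a b - B b a) / 2 := by
  simp [twoForm, ContinuousAlternatingMap.alternatizeUncurryFin_apply, Fin.sum_univ_two,
    Fin.removeNth]
  ring

theorem twoForm_apply_of_skew (B : V →L[ℝ] V →L[ℝ] ℝ) (hB : ∀ a b, B a b = -B b a) (a b : V) :
    twoForm B ![a, b] = B a b := by
  rw [twoForm_apply, hB b a]
  ring

/-- `dΩ = 0` on `U`, where `d` is Mathlib's exterior derivative. -/
def IsClosedOn (U : Set V) (Ω : V → V →L[ℝ] V →L[ℝ] ℝ) : Prop :=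
  ∀ x ∈ U, extDeriv (fun y => twoForm (Ω y)) x = 0

/-- `(U, g, J)` is an almost Hermitian manifold with fundamental 2-form `Ω = g(J ·, ·)`. -/
structure IsAlmostHermitianOn (U : Set V) (g : V → V →L[ℝ] V →L[ℝ] ℝ) (J : V → V →L[ℝ] V)
    (Ω : V → V →L[ℝ] V →L[ℝ] ℝ) : Prop where
  isOpen : IsOpen U
  metric : IsRiemannianMetricOn U g
  smooth_J : ContDiffOn ℝ ∞ J U
  J_sq : ∀ x ∈ U, ∀ a, J x (J x a) = -a
  invariant : ∀ x ∈ U, ∀ a b, g x (J x a) (J x b) = g x a b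
  fundamental : ∀ x ∈ U, ∀ a b, Ω x a b = g x (J x a) b
  smooth_form : ContDiffOn ℝ ∞ Ω U
  skew : ∀ x ∈ U, ∀ a b, Ω x a b = -Ω x b a

/-- `J` is integrable on `U`: it comes from a complex manifold structure, i.e. every point of `U`
lies in the domain of a smooth chart `φ` with values in some `ℂᵐ` such that `dφ ∘ J = i dφ`. -/
def IsIntegrableOn (U : Set V) (J : V → V →L[ℝ] V) : Prop :=
  ∀ x ∈ U, ∃ (m : ℕ) (φ : OpenPartialHomeomorph V (Fin m → ℂ)),
    x ∈ φ.source ∧ φ.source ⊆ U ∧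
    ContDiffOn ℝ ∞ φ φ.source ∧ ContDiffOn ℝ ∞ φ.symm φ.target ∧
    ∀ y ∈ φ.source, ∀ a, fderiv ℝ φ y (J y a) = Complex.I • fderiv ℝ φ y a

/-- `(U, g, J, Ω)` is a Kähler manifold. -/
structure IsKahlerOn (U : Set V) (g : V → V →L[ℝ] V →L[ℝ] ℝ) (J : V → V →L[ℝ] V)
    (Ω : V → V →L[ℝ] V →L[ℝ] ℝ) : Prop where
  almostHermitian : IsAlmostHermitianOn U g J Ω
  integrable : IsIntegrableOn U J
  closed : IsClosedOn U Ω

end Kahler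

/-! ## Statistical models and the Fisher metric -/

/-- The space `ℝⁿ` of parameters `θ = (θ₁, …, θₙ)`. -/
abbrev Param (n : ℕ) : Type := EuclideanSpace ℝ (Fin n)

variable {n : ℕ}

/-- The coordinate vector `∂/∂θᵢ`. -/
def basisVec (i : Fin n) : Param n := EuclideanSpace.single i 1

/-- The partial derivative `∂f/∂θᵢ`. -/
def partialD (i : Fin n) (f : Param n → ℝ) (θ : Param n) : ℝ := fderiv ℝ f θ (basisVec i)

section Model

variable {𝒳 : Type*} [MeasurableSpace 𝒳]

/-- The probability distribution `p_θ` with density `p θ` with respect to `μ`. -/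
def law (μ : Measure 𝒳) (p : Param n → 𝒳 → ℝ) (θ : Param n) : Measure 𝒳 :=
  μ.withDensity fun x => ENNReal.ofReal (p θ x)

/-- `S = {p_θ : θ ∈ Θ}` is a statistical model on the sample space `𝒳`, parametrized by the open
set `Θ ⊆ ℝⁿ`: positive probability densities depending smoothly and injectively on `θ`. Thus `θ` is
a global coordinate system on `S`, and `S` is identified with `Θ` through it. -/
structure IsStatisticalModel (Θ : Set (Param n)) (μ : Measure 𝒳) (p : Param n → 𝒳 → ℝ) :
    Prop where
  isOpen : IsOpen Θ
  pos : ∀ θ ∈ Θ, ∀ x, 0 < p θ x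
  measurable : ∀ θ ∈ Θ, Measurable (p θ)
  prob : ∀ θ ∈ Θ, IsProbabilityMeasure (law μ p θ)
  smooth : ∀ x, ContDiffOn ℝ ∞ (fun θ => p θ x) Θ
  injOn : InjOn (law μ p) Θ

/-- The log-likelihood `l(x, θ) = log p_θ(x)`. -/
def logLik (p : Param n → 𝒳 → ℝ) (x : 𝒳) (θ : Param n) : ℝ := Real.log (p θ x)

/-- `h` is the Fisher metric: `h(∂ᵢ, ∂ⱼ) = -𝔼_θ[∂ᵢ ∂ⱼ l(x, θ)]`, the expectations existing. -/
def IsFisherMetric (Θ : Set (Param n)) (μ : Measure 𝒳) (p : Param n → 𝒳 → ℝ)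
    (h : Param n → Param n →L[ℝ] Param n →L[ℝ] ℝ) : Prop :=
  ∀ θ ∈ Θ, ∀ i j : Fin n,
    Integrable (fun x => partialD i (partialD j (logLik p x)) θ) (law μ p θ) ∧
    h θ (basisVec i) (basisVec j) = -∫ x, partialD i (partialD j (logLik p x)) θ ∂(law μ p θ)

end Model

/-! ## Affine connections and statistical manifolds -/

/-- An affine connection on the open set `Θ ⊆ ℝⁿ`: an operator `(X, Y) ↦ ∇_X Y` on smooth vector
fields on `Θ`. (Vector fields are functions on all of `ℝⁿ`, but only their values on `Θ` matter.) -/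
structure AffineConnection (Θ : Set (Param n)) where
  nabla : (Param n → Param n) → (Param n → Param n) → Param n → Param n
  smooth : ∀ X Y, ContDiffOn ℝ ∞ X Θ → ContDiffOn ℝ ∞ Y Θ → ContDiffOn ℝ ∞ (nabla X Y) Θ
  add_left : ∀ X X' Y, ContDiffOn ℝ ∞ X Θ → ContDiffOn ℝ ∞ X' Θ → ContDiffOn ℝ ∞ Y Θ →
    ∀ θ ∈ Θ, nabla (fun η => X η + X' η) Y θ = nabla X Y θ + nabla X' Y θ
  smul_left : ∀ (f : Param n → ℝ) X Y, ContDiffOn ℝ ∞ f Θ → ContDiffOn ℝ ∞ X Θ →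
    ContDiffOn ℝ ∞ Y Θ → ∀ θ ∈ Θ, nabla (fun η => f η • X η) Y θ = f θ • nabla X Y θ
  add_right : ∀ X Y Y', ContDiffOn ℝ ∞ X Θ → ContDiffOn ℝ ∞ Y Θ → ContDiffOn ℝ ∞ Y' Θ →
    ∀ θ ∈ Θ, nabla X (fun η => Y η + Y' η) θ = nabla X Y θ + nabla X Y' θ
  leibniz : ∀ (f : Param n → ℝ) X Y, ContDiffOn ℝ ∞ f Θ → ContDiffOn ℝ ∞ X Θ →
    ContDiffOn ℝ ∞ Y Θ → ∀ θ ∈ Θ,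
    nabla X (fun η => f η • Y η) θ = (fderiv ℝ f θ (X θ)) • Y θ + f θ • nabla X Y θ

namespace AffineConnection

variable {Θ : Set (Param n)} (D : AffineConnection Θ)

/-- The torsion `T(X, Y) = ∇_X Y - ∇_Y X - [X, Y]`. -/
def torsion (X Y : Param n → Param n) (θ : Param n) : Param n :=
  D.nabla X Y θ - D.nabla Y X θ - VectorField.lieBracket ℝ X Y θ

/-- The curvature `R(X, Y)Z = ∇_X ∇_Y Z - ∇_Y ∇_X Z - ∇_[X, Y] Z`. -/
def curvature (X Y Z : Param n → Param n) (θ : Param n) : Param n :=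
  D.nabla X (D.nabla Y Z) θ - D.nabla Y (D.nabla X Z) θ
    - D.nabla (VectorField.lieBracket ℝ X Y) Z θ

def IsTorsionFree : Prop :=
  ∀ X Y, ContDiffOn ℝ ∞ X Θ → ContDiffOn ℝ ∞ Y Θ → ∀ θ ∈ Θ, D.torsion X Y θ = 0

/-- The curvature tensor vanishes. -/
def IsFlat : Prop :=
  ∀ X Y Z, ContDiffOn ℝ ∞ X Θ → ContDiffOn ℝ ∞ Y Θ → ContDiffOn ℝ ∞ Z Θ →
    ∀ θ ∈ Θ, D.curvature X Y Z θ = 0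

/-- `(∇_X h)(Y, Z) = X(h(Y, Z)) - h(∇_X Y, Z) - h(Y, ∇_X Z)`. -/
def nablaMetric (h : Param n → Param n →L[ℝ] Param n →L[ℝ] ℝ) (X Y Z : Param n → Param n)
    (θ : Param n) : ℝ :=
  fderiv ℝ (fun η => h η (Y η) (Z η)) θ (X θ)
    - h θ (D.nabla X Y θ) (Z θ) - h θ (Y θ) (D.nabla X Z θ)

end AffineConnection

/-- `(Θ, h, ∇)` is a statistical manifold: `h` is a Riemannian metric, `∇` is torsion-free and the
cubic tensor `∇h` is totally symmetric. -/
structure IsStatisticalManifold (Θ : Set (Param n)) (h : Param n → Param n →L[ℝ] Param n →L[ℝ] ℝ)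
    (D : AffineConnection Θ) : Prop where
  metric : IsRiemannianMetricOn Θ h
  torsionFree : D.IsTorsionFree
  symm_left : ∀ X Y Z, ContDiffOn ℝ ∞ X Θ → ContDiffOn ℝ ∞ Y Θ → ContDiffOn ℝ ∞ Z Θ →
    ∀ θ ∈ Θ, D.nablaMetric h X Y Z θ = D.nablaMetric h Y X Z θ
  symm_right : ∀ X Y Z, ContDiffOn ℝ ∞ X Θ → ContDiffOn ℝ ∞ Y Θ → ContDiffOn ℝ ∞ Z Θ →
    ∀ θ ∈ Θ, D.nablaMetric h X Y Z θ = D.nablaMetric h X Z Y θ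

/-! ## Dombrowski's construction -/

/-- The tangent bundle `TS = Θ × ℝⁿ`, with coordinates `(θ, θ̇)`, an open subset of `ℝⁿ × ℝⁿ`. The
projection `π` is the first one; a tangent vector `A` of `TS` at a point is a pair
`(∑ aⁱ ∂/∂θᵢ) + (∑ bⁱ ∂/∂θ̇ᵢ)`, written `(a, b)`, with `π_* A = a`. -/
def tangentBundle (Θ : Set (Param n)) : Set (Param n × Param n) := Θ ×ˢ univ

section Dombrowski

variable {Θ : Set (Param n)} (D : AffineConnection Θ)
  (h : Param n → Param n →L[ℝ] Param n →L[ℝ] ℝ)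

/-- The Christoffel symbols as a bilinear map, `(a, u) ↦ ∑ aⁱ uʲ (∇_{∂ᵢ} ∂ⱼ)(θ)`. -/
def christoffel (θ : Param n) : Param n →L[ℝ] Param n →L[ℝ] Param n :=
  ∑ i : Fin n, ∑ j : Fin n,
    (EuclideanSpace.proj i : Param n →L[ℝ] ℝ).smulRight
      ((EuclideanSpace.proj j : Param n →L[ℝ] ℝ).smulRight
        (D.nabla (fun _ => basisVec i) (fun _ => basisVec j) θ))

/-- The connector `K : T(TS) → TS` of `∇` at the point `z = (θ, u)` of `TS`:
`K(a, b) = b + ∑ aⁱ uʲ (∇_{∂ᵢ} ∂ⱼ)(θ)`. It satisfies `∇_X Y = K (Y_* X)`, see `connector_spec`. -/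
def connector (z : Param n × Param n) : (Param n × Param n) →L[ℝ] Param n :=
  ContinuousLinearMap.snd ℝ (Param n) (Param n) +
    ((christoffel D z.1).flip z.2).comp (ContinuousLinearMap.fst ℝ (Param n) (Param n))

theorem nabla_sum (X : Param n → Param n) (hX : ContDiffOn ℝ ∞ X Θ) {ι : Type*}
    (s : Finset ι) (Y : ι → Param n → Param n) (hY : ∀ j, ContDiffOn ℝ ∞ (Y j) Θ)
    (θ : Param n) (hθ : θ ∈ Θ) :
    D.nabla X (fun η => ∑ j ∈ s, Y j η) θ = ∑ j ∈ s, D.nabla X (Y j) θ := by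
  classical
  induction s using Finset.induction_on with
  | empty =>
    have := D.leibniz (fun _ => 0) X (fun _ => 0) contDiffOn_const hX contDiffOn_const θ hθ
    simpa using this
  | insert a s ha ih =>
    simp only [Finset.sum_insert ha]
    rw [D.add_right X (Y a) _ hX (hY a) (ContDiffOn.sum fun j _ => hY j) θ hθ, ih]

theorem sum_nabla {ι : Type*} (s : Finset ι) (X : ι → Param n → Param n)
    (hX : ∀ j, ContDiffOn ℝ ∞ (X j) Θ) (Y : Param n → Param n) (hY : ContDiffOn ℝ ∞ Y Θ)
    (θ : Param n) (hθ : θ ∈ Θ) :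
    D.nabla (fun η => ∑ j ∈ s, X j η) Y θ = ∑ j ∈ s, D.nabla (X j) Y θ := by
  classical
  induction s using Finset.induction_on with
  | empty =>
    have := D.smul_left (fun _ => 0) (fun _ => 0) Y contDiffOn_const contDiffOn_const hY θ hθ
    simpa using this
  | insert a s ha ih =>
    simp only [Finset.sum_insert ha]
    rw [D.add_left (X a) _ Y (hX a) (ContDiffOn.sum fun j _ => hX j) hY θ hθ, ih]

theorem eq_sum_basisVec (a : Param n) : a = ∑ i : Fin n, a i • basisVec i := by
  ext k
  simp [basisVec, Finset.sum_apply, Pi.single_apply]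

theorem contDiffOn_coord {Y : Param n → Param n} (hY : ContDiffOn ℝ ∞ Y Θ) (j : Fin n) :
    ContDiffOn ℝ ∞ (fun η => Y η j) Θ :=
  (EuclideanSpace.proj j : Param n →L[ℝ] ℝ).contDiff.comp_contDiffOn hY

/-- The defining property of the connector: `∇_X Y = K (Y_* X)`. -/
theorem connector_spec (hΘ : IsOpen Θ) (X Y : Param n → Param n) (hX : ContDiffOn ℝ ∞ X Θ)
    (hY : ContDiffOn ℝ ∞ Y Θ) (θ : Param n) (hθ : θ ∈ Θ) :
    D.nabla X Y θ = connector D (θ, Y θ) (X θ, fderiv ℝ Y θ (X θ)) := by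
  have hdiff : DifferentiableAt ℝ Y θ :=
    (hY.contDiffAt (hΘ.mem_nhds hθ)).differentiableAt (by simp)
  have hYe : Y = fun η => ∑ j : Fin n, Y η j • basisVec j :=
    funext fun η => eq_sum_basisVec (Y η)
  have hXe : X = fun η => ∑ i : Fin n, X η i • basisVec i :=
    funext fun η => eq_sum_basisVec (X η)
  have hc : ∀ j, ContDiffOn ℝ ∞ (fun _ : Param n => (basisVec j : Param n)) Θ :=
    fun j => contDiffOn_const
  have hder : ∀ j, fderiv ℝ (fun η => Y η j) θ (X θ) = (fderiv ℝ Y θ (X θ)) j := by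
    intro j
    have := ((EuclideanSpace.proj j : Param n →L[ℝ] ℝ).hasFDerivAt.comp θ
      hdiff.hasFDerivAt).fderiv
    have h2 := congrArg (fun L : Param n →L[ℝ] ℝ => L (X θ)) this
    simpa [Function.comp_def] using h2
  have hXc : ∀ j, D.nabla X (fun _ => basisVec j) θ
      = ∑ i : Fin n, X θ i • D.nabla (fun _ => basisVec i) (fun _ => basisVec j) θ := by
    intro j
    conv_lhs => rw [hXe]
    rw [sum_nabla D Finset.univ (fun i η => X η i • basisVec i)
      (fun i => (contDiffOn_coord hX i).smul (hc i)) _ (hc j) θ hθ]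
    refine Finset.sum_congr rfl fun i _ => ?_
    exact D.smul_left (fun η => X η i) (fun _ => basisVec i) _ (contDiffOn_coord hX i) (hc i)
      (hc j) θ hθ
  have key : D.nabla X Y θ = ∑ j : Fin n, ((fderiv ℝ Y θ (X θ)) j • basisVec j
      + Y θ j • D.nabla X (fun _ => basisVec j) θ) := by
    conv_lhs => rw [hYe]
    rw [nabla_sum D X hX Finset.univ (fun j η => Y η j • basisVec j)
      (fun j => (contDiffOn_coord hY j).smul (hc j)) θ hθ]
    refine Finset.sum_congr rfl fun j _ => ?_
    rw [← hder j]
    exact D.leibniz (fun η => Y η j) X (fun _ => basisVec j) (contDiffOn_coord hY j) hX (hc j) θ hθ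
  rw [key, Finset.sum_add_distrib, ← eq_sum_basisVec]
  simp only [hXc, connector, christoffel, add_apply,
    ContinuousLinearMap.coe_snd', ContinuousLinearMap.comp_apply, ContinuousLinearMap.coe_fst',
    ContinuousLinearMap.flip_apply, sum_apply,
    ContinuousLinearMap.smulRight_apply, Finset.smul_sum, smul_apply]
  rw [Finset.sum_comm]
  congr 1
  refine Finset.sum_congr rfl fun i _ => Finset.sum_congr rfl fun j _ => ?_
  rw [smul_comm]
  rfl

/-- The isomorphism `T_u(TS) ≅ T_pS ⊕ T_pS`, `A ↦ (π_* A, K A)`, at the point `z = (p, u)`. A triple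
`(u, v, w)` stands for the tangent vector `(triple D z).symm (v, w)`. -/
def triple (z : Param n × Param n) : (Param n × Param n) ≃L[ℝ] (Param n × Param n) :=
  ContinuousLinearEquiv.equivOfInverse
    ((ContinuousLinearMap.fst ℝ (Param n) (Param n)).prod (connector D z))
    ((ContinuousLinearMap.fst ℝ (Param n) (Param n)).prod
      (ContinuousLinearMap.snd ℝ (Param n) (Param n) -
        ((christoffel D z.1).flip z.2).comp (ContinuousLinearMap.fst ℝ (Param n) (Param n))))
    (fun A => by ext <;> simp [connector])
    (fun A => by ext <;> simp [connector])

/-- `g((u, v, w), (u, v̄, w̄)) = h(v, v̄) + h(w, w̄)`. -/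
def dombrowskiMetric (z : Param n × Param n) :
    (Param n × Param n) →L[ℝ] (Param n × Param n) →L[ℝ] ℝ :=
  let hor := ContinuousLinearMap.fst ℝ (Param n) (Param n)
  let ver := connector D z
  (h z.1).bilinearComp hor hor + (h z.1).bilinearComp ver ver

/-- `ω((u, v, w), (u, v̄, w̄)) = h(v, w̄) - h(w, v̄)`. -/
def dombrowskiForm (z : Param n × Param n) :
    (Param n × Param n) →L[ℝ] (Param n × Param n) →L[ℝ] ℝ :=
  let hor := ContinuousLinearMap.fst ℝ (Param n) (Param n)
  let ver := connector D z
  (h z.1).bilinearComp hor ver - (h z.1).bilinearComp ver hor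

/-- `J(u, v, w) = (u, -w, v)`. -/
def dombrowskiJ (z : Param n × Param n) : (Param n × Param n) →L[ℝ] (Param n × Param n) :=
  ((triple D z).symm : (Param n × Param n) →L[ℝ] (Param n × Param n)).comp
    (((-ContinuousLinearMap.snd ℝ (Param n) (Param n)).prod
      (ContinuousLinearMap.fst ℝ (Param n) (Param n))).comp
        (triple D z : (Param n × Param n) →L[ℝ] (Param n × Param n)))

end Dombrowski

end StatKahler

end

/-!
Let `Γ` be the Christoffel map of `∇`, so that `K(a, b) = b + Γ(a, u)` at `(θ, u)`. The pointwise
identities, and the smoothness of `g`, `J` and `ω`, are linear algebra in the splitting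
`A ↦ (π_* A, K A)`. Two points have content.

*Integrability of `J`.* Flatness of `∇` is the integrability condition of the equation
`dP(a) = P ∘ Γ(a)` for a matrix-valued function `P` on `Θ`. Near every point it has a solution which
is the identity at that point (`exists_hasFDerivAt_of_flat`): one solves the equation along rays,
and Grönwall's inequality, applied to the defect of first-order approximation between two nearby
rays, shows that the solution found ray by ray is differentiable with the prescribed derivative.
As `Γ` is symmetric, `P` is closed, so `P = dX` by the Poincaré lemma (`exists_flat_coordinates`).
Then `φ(θ, u) = X(θ) + i P(θ) u` satisfies `dφ(A) = P (π_* A) + i P (K A)`, which is complex linear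
with respect to `J(v, w) = (-w, v)`, and the inverse function theorem makes `φ` a chart
(`isIntegrableOn_of_flat`).

*Closedness of `ω`.* Let `α` be the 1-form `α(a, b) = h_θ(u, a)` on the tangent bundle. By the
Codazzi equation for `h` and the symmetry of `Γ`, `ω = -dα` (`twoForm_dombrowskiForm`); hence
`dω = 0`. The curvature plays no role here.
-/

namespace StatKahler

set_option maxSynthPendingDepth 3

/-! ### Linear differential equations on the unit interval -/

section LinearODE

variable {F : Type*} [NormedAddCommGroup F] [NormedSpace ℝ F]

/-- The Picard–Lindelöf theorem needs no subdivision of the interval when the coefficient is at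
most `1 / 2`: the right-hand side is then at most `‖y₀‖` on the closed ball of radius `‖y₀‖`
about `y₀`, so a solution cannot leave that ball in unit time. -/
theorem exists_linearODE_solution [CompleteSpace F] {B : ℝ → F →L[ℝ] F}
    (hB : ContinuousOn B (Icc 0 1)) (hB' : ∀ t ∈ Icc (0 : ℝ) 1, ‖B t‖ ≤ 1 / 2) (y₀ : F) :
    ∃ z : ℝ → F, z 0 = y₀ ∧
      ∀ t ∈ Icc (0 : ℝ) 1, HasDerivWithinAt z (B t (z t)) (Icc 0 1) t := by
  have h0 : (0 : ℝ) ∈ Icc (0 : ℝ) 1 := by simp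
  have hPL : IsPicardLindelof (fun t y => B t y) (⟨0, h0⟩ : Icc (0 : ℝ) 1) y₀ ‖y₀‖₊ 0 ‖y₀‖₊ 1 := by
    refine ⟨fun t ht => ?_, fun x _ => hB.clm_apply continuousOn_const, fun t ht x hx => ?_, ?_⟩
    · refine ((B t).lipschitz.weaken ?_).lipschitzOnWith
      rw [← NNReal.coe_le_coe, coe_nnnorm, NNReal.coe_one]
      exact (hB' t ht).trans (by norm_num)
    · rw [mem_closedBall_iff_norm, coe_nnnorm] at hx
      have hx' : ‖x‖ ≤ 2 * ‖y₀‖ := by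
        have := norm_add_le (x - y₀) y₀
        rw [sub_add_cancel] at this
        linarith
      rw [coe_nnnorm]
      calc ‖B t x‖ ≤ ‖B t‖ * ‖x‖ := (B t).le_opNorm x
        _ ≤ 1 / 2 * (2 * ‖y₀‖) := by gcongr; exact hB' t ht
        _ = ‖y₀‖ := by ring
    · simp
  exact hPL.exists_eq_forall_mem_Icc_hasDerivWithinAt₀

theorem norm_le_of_norm_deriv_le_add {f f' : ℝ → F} {δ ε : ℝ} (hδ : 0 ≤ δ) (hε : 0 ≤ ε)
    (hf : ∀ t ∈ Icc (0 : ℝ) 1, HasDerivWithinAt f (f' t) (Icc 0 1) t) (h0 : ‖f 0‖ ≤ δ)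
    (bound : ∀ t ∈ Icc (0 : ℝ) 1, ‖f' t‖ ≤ ‖f t‖ + ε) :
    ∀ t ∈ Icc (0 : ℝ) 1, ‖f t‖ ≤ 3 * δ + 2 * ε := by
  intro t ht
  have key := norm_le_gronwallBound_of_norm_deriv_right_le (f := f) (f' := f') (K := 1) (a := 0)
    (b := 1) (fun s hs => (hf s hs).continuousWithinAt)
    (fun s hs => (hf s ⟨hs.1, hs.2.le⟩).mono_of_mem_nhdsWithin
      (mem_nhdsWithin.2 ⟨Iio 1, isOpen_Iio, hs.2, fun u hu => ⟨hs.1.trans hu.2, (le_of_lt hu.1)⟩⟩))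
    h0 (fun s hs => by simpa using bound s ⟨hs.1, hs.2.le⟩) t ht
  refine key.trans ((gronwallBound_mono hδ hε zero_le_one (sub_le_sub_right ht.2 0)).trans ?_)
  rw [gronwallBound_of_K_ne_0 one_ne_zero]
  have he : Real.exp 1 ≤ 3 := Real.exp_one_lt_d9.le.trans (by norm_num)
  simp only [sub_zero, one_mul, div_one]
  nlinarith

end LinearODE

/-! ### Parallel sections of a flat linear connection -/

section Parallel

variable {V F : Type*} [NormedAddCommGroup V] [NormedSpace ℝ V] [NormedAddCommGroup F]
  [NormedSpace ℝ F]

/-- Let `z`, `z'` be the values at time `t` of the solutions along the rays `x = x₀ + t v` and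
`x' = x₀ + t v'`. The left-hand side is the norm of the time derivative of the defect
`z' - z - t A(x)(v' - v) z`. The integrability condition
`dA(a)(b) + A(b) A(a) = dA(b)(a) + A(a) A(b)` turns this derivative into
`A(x')(v')` applied to the defect, up to an error that is quadratic in `v' - v`. -/
theorem norm_defect_deriv_le {A : V → V →L[ℝ] F →L[ℝ] F} {A' : V → V →L[ℝ] V →L[ℝ] F →L[ℝ] F}
    {x x' v v' : V} {t M C : ℝ} {z z' : F} (ht : t ∈ Icc (0 : ℝ) 1)
    (hflat : ∀ a b, A' x a b + A x b ∘L A x a = A' x b a + A x a ∘L A x b)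
    (hx : x' - x = t • (v' - v)) (hM : 0 ≤ M) (hAx : ‖A x‖ ≤ M) (hA'x : ‖A' x‖ ≤ M)
    (hlip : ‖A x' - A x‖ ≤ M * ‖x' - x‖)
    (hquad : ‖A x' - A x - A' x (x' - x)‖ ≤ M * ‖x' - x‖ * ‖x' - x‖)
    (hv' : ‖v'‖ ≤ 1) (hAx' : ‖A x' v'‖ ≤ 1) (hz : ‖z‖ ≤ C) :
    ‖A x' v' z' - A x v z - (A x (v' - v) z + t • (A' x v (v' - v) z + A x (v' - v) (A x v z)))‖
      ≤ ‖z' - z - t • A x (v' - v) z‖ + (2 * M + 2 * M * M) * C * ‖v' - v‖ ^ 2 := by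
  set δ := v' - v with hδ
  have hflat' := congrArg (fun L : F →L[ℝ] F => L z) (hflat v δ)
  simp only [add_apply, ContinuousLinearMap.comp_apply] at hflat'
  have hv'δ : v' = v + δ := by rw [hδ]; abel
  have hsplit : A x' v' z' - A x v z - (A x δ z + t • (A' x v δ z + A x δ (A x v z)))
      = A x' v' (z' - z - t • A x δ z) + (A x' - A x - A' x (x' - x)) v' z
        + t • A' x δ δ z + t • ((A x' - A x) v' + A x δ) (A x δ z) := by
    rw [hflat', hx]
    simp only [hv'δ, map_add, map_sub, map_smul, add_apply, sub_apply, smul_apply]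
    module
  have hC : 0 ≤ C := (norm_nonneg z).trans hz
  have ht' : ‖t‖ ≤ 1 := by rw [Real.norm_of_nonneg ht.1]; exact ht.2
  have hxδ : ‖x' - x‖ ≤ ‖δ‖ := by
    rw [hx, norm_smul]
    exact mul_le_of_le_one_left (norm_nonneg _) ht'
  have b1 : ‖A x' v' (z' - z - t • A x δ z)‖ ≤ ‖z' - z - t • A x δ z‖ :=
    ((A x' v').le_opNorm _).trans (mul_le_of_le_one_left (norm_nonneg _) hAx')
  have b2 : ‖(A x' - A x - A' x (x' - x)) v' z‖ ≤ M * C * ‖δ‖ ^ 2 :=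
    calc ‖(A x' - A x - A' x (x' - x)) v' z‖
        ≤ ‖A x' - A x - A' x (x' - x)‖ * ‖v'‖ * ‖z‖ := ContinuousLinearMap.le_opNorm₂ _ _ _
      _ ≤ (M * ‖δ‖ * ‖δ‖) * 1 * C := by gcongr; exact hquad.trans (by gcongr)
      _ = M * C * ‖δ‖ ^ 2 := by ring
  have b3 : ‖t • A' x δ δ z‖ ≤ M * C * ‖δ‖ ^ 2 := by
    rw [norm_smul]
    calc ‖t‖ * ‖A' x δ δ z‖ ≤ 1 * (‖A' x δ‖ * ‖δ‖ * ‖z‖) := by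
          gcongr
          exact ContinuousLinearMap.le_opNorm₂ _ _ _
      _ ≤ 1 * ((M * ‖δ‖) * ‖δ‖ * C) := by
          gcongr
          exact ((A' x).le_opNorm δ).trans (by gcongr)
      _ = M * C * ‖δ‖ ^ 2 := by ring
  have b4 : ‖t • ((A x' - A x) v' + A x δ) (A x δ z)‖ ≤ 2 * M * M * C * ‖δ‖ ^ 2 := by
    have e1 : ‖(A x' - A x) v' + A x δ‖ ≤ 2 * M * ‖δ‖ :=
      calc ‖(A x' - A x) v' + A x δ‖ ≤ ‖A x' - A x‖ * ‖v'‖ + ‖A x‖ * ‖δ‖ :=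
            norm_add_le_of_le ((A x' - A x).le_opNorm _) ((A x).le_opNorm _)
        _ ≤ (M * ‖δ‖) * 1 + M * ‖δ‖ := by gcongr; exact hlip.trans (by gcongr)
        _ = 2 * M * ‖δ‖ := by ring
    have e2 : ‖A x δ z‖ ≤ M * ‖δ‖ * C :=
      (ContinuousLinearMap.le_opNorm₂ _ _ _).trans (by gcongr)
    rw [norm_smul]
    calc ‖t‖ * ‖((A x' - A x) v' + A x δ) (A x δ z)‖
        ≤ 1 * ((2 * M * ‖δ‖) * (M * ‖δ‖ * C)) := by
          gcongr
          exact (ContinuousLinearMap.le_opNorm _ _).trans (by gcongr)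
      _ = 2 * M * M * C * ‖δ‖ ^ 2 := by ring
  rw [hsplit]
  calc _ ≤ _ := norm_add₄_le
    _ ≤ ‖z' - z - t • A x δ z‖ + M * C * ‖δ‖ ^ 2 + M * C * ‖δ‖ ^ 2
        + 2 * M * M * C * ‖δ‖ ^ 2 := by gcongr
    _ = _ := by ring

/-- **Frobenius theorem** for a linear total differential equation `dy = A(·) y`, on a ball on
which `A` and its derivative are controlled: solve the equation along rays from the centre, and
compare two neighbouring rays with Grönwall's inequality. -/
theorem exists_hasFDerivAt_of_flat_of_bounds [CompleteSpace F]
    {A : V → V →L[ℝ] F →L[ℝ] F} {A' : V → V →L[ℝ] V →L[ℝ] F →L[ℝ] F} {x₀ : V} {r M : ℝ}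
    (hA : ∀ x ∈ Metric.ball x₀ r, HasFDerivAt A (A' x) x)
    (hflat : ∀ x ∈ Metric.ball x₀ r, ∀ a b,
      A' x a b + A x b ∘L A x a = A' x b a + A x a ∘L A x b)
    (hr0 : 0 < r) (hr : r ≤ 1) (hM : 0 ≤ M) (hMr : M * r ≤ 1 / 2)
    (hbA : ∀ x ∈ Metric.ball x₀ r, ‖A x‖ ≤ M) (hbA' : ∀ x ∈ Metric.ball x₀ r, ‖A' x‖ ≤ M)
    (hlip : ∀ x ∈ Metric.ball x₀ r, ∀ x' ∈ Metric.ball x₀ r, ‖A' x' - A' x‖ ≤ M * ‖x' - x‖)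
    (y₀ : F) :
    ∃ y : V → F, y x₀ = y₀ ∧ ∀ x ∈ Metric.ball x₀ r, HasFDerivAt y ((A x).flip (y x)) x := by
  have hmem : ∀ v : V, ‖v‖ < r → ∀ t ∈ Icc (0 : ℝ) 1, x₀ + t • v ∈ Metric.ball x₀ r := by
    intro v hv t ht
    rw [mem_ball_iff_norm, add_sub_cancel_left, norm_smul, Real.norm_of_nonneg ht.1]
    exact (mul_le_of_le_one_left (norm_nonneg _) ht.2).trans_lt hv
  have hκ : ∀ v : V, ‖v‖ < r → ∀ t ∈ Icc (0 : ℝ) 1, ‖A (x₀ + t • v) v‖ ≤ 1 / 2 := fun v hv t ht =>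
    (((A (x₀ + t • v)).le_opNorm v).trans
      (mul_le_mul (hbA _ (hmem v hv t ht)) hv.le (norm_nonneg _) hM)).trans hMr
  have hAt : ∀ v : V, ‖v‖ < r → ∀ t ∈ Icc (0 : ℝ) 1,
      HasDerivAt (fun s : ℝ => A (x₀ + s • v)) (A' (x₀ + t • v) v) t := by
    intro v hv t ht
    have h1 : HasDerivAt (fun s : ℝ => x₀ + s • v) v t := by
      simpa using ((hasDerivAt_id t).smul_const v).const_add x₀
    exact (hA _ (hmem v hv t ht)).comp_hasDerivAt t h1
  have hsol : ∀ v : V, ∃ z : ℝ → F, ‖v‖ < r → z 0 = y₀ ∧ ∀ t ∈ Icc (0 : ℝ) 1,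
      HasDerivWithinAt z (A (x₀ + t • v) v (z t)) (Icc 0 1) t := by
    intro v
    by_cases hv : ‖v‖ < r
    · obtain ⟨z, hz⟩ := exists_linearODE_solution (B := fun t => A (x₀ + t • v) v)
        (fun t ht => ((hAt v hv t ht).continuousAt.clm_apply
          continuousAt_const).continuousWithinAt) (hκ v hv) y₀
      exact ⟨z, fun _ => hz⟩
    · exact ⟨0, fun h => absurd h hv⟩
  choose z hz using hsol
  have hzb : ∀ v : V, ‖v‖ < r → ∀ t ∈ Icc (0 : ℝ) 1, ‖z v t‖ ≤ 3 * ‖y₀‖ := by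
    intro v hv t ht
    have := norm_le_of_norm_deriv_le_add (norm_nonneg y₀) le_rfl (hz v hv).2
      (by rw [(hz v hv).1]) (fun s hs => by
        rw [add_zero]
        refine (ContinuousLinearMap.le_opNorm _ _).trans
          (mul_le_of_le_one_left (norm_nonneg _) ((hκ v hv s hs).trans (by norm_num)))) t ht
    simpa using this
  have hconv := convex_ball x₀ r
  have hAlip : ∀ x ∈ Metric.ball x₀ r, ∀ x' ∈ Metric.ball x₀ r,
      ‖A x' - A x‖ ≤ M * ‖x' - x‖ := fun x hx x' hx' =>
    hconv.norm_image_sub_le_of_norm_hasFDerivWithin_le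
      (fun w hw => (hA w hw).hasFDerivWithinAt) hbA' hx hx'
  have hAquad : ∀ x ∈ Metric.ball x₀ r, ∀ x' ∈ Metric.ball x₀ r,
      ‖A x' - A x - A' x (x' - x)‖ ≤ M * ‖x' - x‖ * ‖x' - x‖ := by
    intro x hx x' hx'
    refine (convex_segment x x').norm_image_sub_le_of_norm_hasFDerivWithin_le'
      (fun w hw => (hA w (hconv.segment_subset hx hx' hw)).hasFDerivWithinAt)
      (fun w hw => ?_) (left_mem_segment ℝ x x') (right_mem_segment ℝ x x')
    refine (hlip x hx w (hconv.segment_subset hx hx' hw)).trans ?_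
    gcongr
    exact norm_sub_le_of_mem_segment hw
  -- the value at time `1` of the solution along the ray through `x`
  refine ⟨fun x => z (x - x₀) 1, ?_, fun x hx => ?_⟩
  · -- the solution along the constant ray is constant
    have h0 : ‖x₀ - x₀‖ < r := by simpa
    have hconst : ∀ t ∈ Icc (0 : ℝ) 1,
        HasDerivWithinAt (fun s => z (x₀ - x₀) s - y₀) 0 (Icc 0 1) t := fun t ht => by
      simpa using ((hz _ h0).2 t ht).sub_const y₀
    have := norm_le_of_norm_deriv_le_add le_rfl le_rfl hconst
      (by simpa [sub_eq_zero] using (hz _ h0).1)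
      (fun t _ => by simp) 1 (by simp)
    simpa [sub_eq_zero] using this
  · set v := x - x₀ with hv
    have hvr : ‖v‖ < r := by rwa [mem_ball_iff_norm] at hx
    have hdef : ∀ v' : V, ‖v'‖ < r → ‖z v' 1 - z v 1 - A x (v' - v) (z v 1)‖
        ≤ 2 * ((2 * M + 2 * M * M) * (3 * ‖y₀‖) * ‖v' - v‖ ^ 2) := by
      intro v' hv'r
      have hder : ∀ t ∈ Icc (0 : ℝ) 1, HasDerivWithinAt
          (fun s => z v' s - z v s - s • A (x₀ + s • v) (v' - v) (z v s))
          (A (x₀ + t • v') v' (z v' t) - A (x₀ + t • v) v (z v t)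
            - (A (x₀ + t • v) (v' - v) (z v t)
              + t • (A' (x₀ + t • v) v (v' - v) (z v t)
                + A (x₀ + t • v) (v' - v) (A (x₀ + t • v) v (z v t))))) (Icc 0 1) t := by
        intro t ht
        have h1 : HasDerivWithinAt (fun s => A (x₀ + s • v) (v' - v))
            (A' (x₀ + t • v) v (v' - v)) (Icc 0 1) t := by
          simpa using (hAt v hvr t ht).hasDerivWithinAt.clm_apply
            (hasDerivWithinAt_const t (Icc 0 1) (v' - v))
        have h2 := h1.clm_apply ((hz v hvr).2 t ht)
        have h3 := (hasDerivWithinAt_id t (Icc (0 : ℝ) 1)).smul h2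
        convert! (((hz v' hv'r).2 t ht).sub ((hz v hvr).2 t ht)).sub h3 using 1
        simp only [id, one_smul]
        abel
      have := norm_le_of_norm_deriv_le_add (δ := 0)
        (ε := (2 * M + 2 * M * M) * (3 * ‖y₀‖) * ‖v' - v‖ ^ 2) le_rfl (by positivity) hder
        (by simp [(hz v' hv'r).1, (hz v hvr).1])
        (fun t ht => norm_defect_deriv_le ht (hflat _ (hmem v hvr t ht))
          (by rw [smul_sub t v' v, add_sub_add_left_eq_sub]) hM
          (hbA _ (hmem v hvr t ht)) (hbA' _ (hmem v hvr t ht))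
          (hAlip _ (hmem v hvr t ht) _ (hmem v' hv'r t ht))
          (hAquad _ (hmem v hvr t ht) _ (hmem v' hv'r t ht))
          (hv'r.le.trans hr)
          ((hκ v' hv'r t ht).trans (by norm_num)) (hzb v hvr t ht)) 1 (by simp)
      simpa [hv] using this
    rw [hasFDerivAt_iff_isLittleO]
    have hO : (fun x' => z (x' - x₀) 1 - z v 1 - (A x).flip (z v 1) (x' - x))
        =O[nhds x] fun x' => ‖x' - x‖ ^ 2 := by
      refine Asymptotics.IsBigO.of_bound (2 * ((2 * M + 2 * M * M) * (3 * ‖y₀‖))) ?_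
      filter_upwards [Metric.isOpen_ball.mem_nhds hx] with x' hx'
      have := hdef (x' - x₀) (by rwa [mem_ball_iff_norm] at hx')
      rw [hv, sub_sub_sub_cancel_right] at this
      rw [norm_pow, norm_norm, ContinuousLinearMap.flip_apply]
      refine this.trans_eq (by ring)
    refine hO.trans_isLittleO ?_
    have h0 : (fun x' => x' - x) =O[nhds x] fun x' => x' - x := Asymptotics.isBigO_refl _ _
    have := (Asymptotics.isLittleO_norm_pow_id (E' := V) one_lt_two).comp_tendsto
      (tendsto_sub_nhds_zero_iff.2 (Filter.tendsto_id (α := V) (x := nhds x)))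
    simpa [Function.comp_def] using this

/-- Local **Frobenius theorem** for the linear total differential equation `dy = A(·) y`. -/
theorem exists_hasFDerivAt_of_flat [CompleteSpace F] {A : V → V →L[ℝ] F →L[ℝ] F} {U : Set V}
    (hU : IsOpen U) (hA : ContDiffOn ℝ ∞ A U)
    (hflat : ∀ x ∈ U, ∀ a b,
      fderiv ℝ A x a b + A x b ∘L A x a = fderiv ℝ A x b a + A x a ∘L A x b)
    {x₀ : V} (hx₀ : x₀ ∈ U) (y₀ : F) :
    ∃ r > 0, Metric.ball x₀ r ⊆ U ∧ ∃ y : V → F, y x₀ = y₀ ∧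
      ∀ x ∈ Metric.ball x₀ r, HasFDerivAt y ((A x).flip (y x)) x := by
  have hAt : ContDiffAt ℝ ∞ A x₀ := hA.contDiffAt (hU.mem_nhds hx₀)
  have hA't : ContDiffAt ℝ 1 (fderiv ℝ A) x₀ := hAt.fderiv_right (by norm_cast)
  obtain ⟨K, s, hs, hK⟩ := hA't.exists_lipschitzOnWith
  set M : ℝ := K + ‖A x₀‖ + ‖fderiv ℝ A x₀‖ + 1 with hMdef
  have hM : 0 < M := by positivity
  have hK0 : (0 : ℝ) ≤ K := K.2
  have n1 := norm_nonneg (A x₀)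
  have n2 := norm_nonneg (fderiv ℝ A x₀)
  have hev1 : ∀ᶠ x in nhds x₀, ‖A x‖ < M :=
    hAt.continuousAt.norm.eventually_lt continuousAt_const (by linarith)
  have hev2 : ∀ᶠ x in nhds x₀, ‖fderiv ℝ A x‖ < M :=
    hA't.continuousAt.norm.eventually_lt continuousAt_const (by linarith)
  obtain ⟨r₀, hr₀, hball⟩ := Metric.mem_nhds_iff.1
    (Filter.inter_mem (Filter.inter_mem (hU.mem_nhds hx₀) hs) (Filter.inter_mem hev1 hev2))
  have hrr : Metric.ball x₀ (min r₀ (min 1 (1 / (2 * M)))) ⊆ Metric.ball x₀ r₀ :=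
    Metric.ball_subset_ball (min_le_left _ _)
  refine ⟨min r₀ (min 1 (1 / (2 * M))), by positivity, fun x hx => (hball (hrr hx)).1.1, ?_⟩
  refine exists_hasFDerivAt_of_flat_of_bounds (A' := fderiv ℝ A) (M := M)
    (fun x hx => ((hA.contDiffAt (hU.mem_nhds (hball (hrr hx)).1.1)).differentiableAt
      (by simp)).hasFDerivAt)
    (fun x hx => hflat x (hball (hrr hx)).1.1) (by positivity)
    ((min_le_right _ _).trans (min_le_left _ _)) hM.le ?_
    (fun x hx => le_of_lt (hball (hrr hx)).2.1) (fun x hx => le_of_lt (hball (hrr hx)).2.2)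
    (fun x hx x' hx' => ?_) y₀
  · calc M * min r₀ (min 1 (1 / (2 * M))) ≤ M * (1 / (2 * M)) := by
          gcongr
          exact (min_le_right _ _).trans (min_le_right _ _)
      _ = 1 / 2 := by field_simp
  · refine (hK.norm_sub_le (hball (hrr hx')).1.2 (hball (hrr hx)).1.2).trans ?_
    gcongr
    linarith

/-- Bootstrapping: if `y` is `C^k`, then so is `dy = A(·) y`, and `y` is `C^(k+1)`. -/
theorem contDiffOn_of_hasFDerivAt_flip {A : V → V →L[ℝ] F →L[ℝ] F} {O : Set V} (hO : IsOpen O)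
    (hA : ContDiffOn ℝ ∞ A O) {y : V → F}
    (hy : ∀ x ∈ O, HasFDerivAt y ((A x).flip (y x)) x) : ContDiffOn ℝ ∞ y O := by
  rw [contDiffOn_infty]
  intro k
  induction k with
  | zero =>
    exact contDiffOn_zero.2 fun x hx => (hy x hx).continuousAt.continuousWithinAt
  | succ k ih =>
    rw [Nat.cast_add, Nat.cast_one, contDiffOn_succ_iff_fderiv_of_isOpen hO]
    refine ⟨fun x hx => (hy x hx).differentiableAt.differentiableWithinAt,
      fun h => absurd h (by simp), ?_⟩
    have hA' : ContDiffOn ℝ k (fun x => (A x).flip) O :=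
      (ContinuousLinearMap.flipₗᵢ ℝ V F F).contDiff.comp_contDiffOn
        (hA.of_le (by exact_mod_cast le_top))
    exact (hA'.clm_apply ih).congr fun x hx => (hy x hx).fderiv

end Parallel

/-! ### Flat coordinates and the complex charts -/

section FlatCoordinates

variable {V : Type*} [NormedAddCommGroup V] [NormedSpace ℝ V] [CompleteSpace V]
  {U : Set V} {Γ : V → V →L[ℝ] V →L[ℝ] V}

/-- A torsion-free flat connection with Christoffel map `Γ` has local coordinates `X` in which its
Christoffel symbols vanish: the differential `P = dX` satisfies `dP(a) = P ∘ Γ(a)`, i.e. its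
components are parallel 1-forms. The frame `P` comes from the Frobenius theorem, by flatness, and
its primitive `X` from the Poincaré lemma, by torsion-freeness. -/
theorem exists_flat_coordinates (hU : IsOpen U) (hΓ : ContDiffOn ℝ ∞ Γ U)
    (hsymm : ∀ x ∈ U, ∀ a b, Γ x a b = Γ x b a)
    (hflat : ∀ x ∈ U, ∀ a b,
      fderiv ℝ Γ x a b + Γ x a ∘L Γ x b = fderiv ℝ Γ x b a + Γ x b ∘L Γ x a)
    {x₀ : V} (hx₀ : x₀ ∈ U) :
    ∃ (O : Set V) (X : V → V) (P : V → V →L[ℝ] V), IsOpen O ∧ x₀ ∈ O ∧ O ⊆ U ∧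
      ContDiffOn ℝ ∞ X O ∧ ContDiffOn ℝ ∞ P O ∧ ∀ x ∈ O, IsUnit (P x) ∧ HasFDerivAt X (P x) x ∧
        HasFDerivAt P ((ContinuousLinearMap.compL ℝ V V V (P x)).comp (Γ x)) x := by
  let R : V → V →L[ℝ] (V →L[ℝ] V) →L[ℝ] (V →L[ℝ] V) := fun x =>
    (ContinuousLinearMap.compL ℝ V V V).flip.comp (Γ x)
  let L := ContinuousLinearMap.compL ℝ V (V →L[ℝ] V) ((V →L[ℝ] V) →L[ℝ] (V →L[ℝ] V))
    (ContinuousLinearMap.compL ℝ V V V).flip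
  have hR : ContDiffOn ℝ ∞ R U := L.contDiff.comp_contDiffOn hΓ
  have hR' : ∀ x ∈ U, ∀ a b, fderiv ℝ R x a b
      = (ContinuousLinearMap.compL ℝ V V V).flip (fderiv ℝ Γ x a b) := by
    intro x hx a b
    have hd : HasFDerivAt Γ (fderiv ℝ Γ x) x :=
      ((hΓ.contDiffAt (hU.mem_nhds hx)).differentiableAt (by simp)).hasFDerivAt
    have : HasFDerivAt R (L.comp (fderiv ℝ Γ x)) x := L.hasFDerivAt.comp x hd
    rw [this.fderiv]
    rfl
  have hRflat : ∀ x ∈ U, ∀ a b,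
      fderiv ℝ R x a b + R x b ∘L R x a = fderiv ℝ R x b a + R x a ∘L R x b := by
    intro x hx a b
    rw [hR' x hx, hR' x hx]
    ext Q c
    have := congrArg (fun S : V →L[ℝ] V => Q (S c)) (hflat x hx a b)
    simpa [R] using this
  obtain ⟨r, hr, hrU, P, hP₀, hP⟩ := exists_hasFDerivAt_of_flat hU hR hRflat hx₀
    (ContinuousLinearMap.id ℝ V)
  have hPs : ContDiffOn ℝ ∞ P (Metric.ball x₀ r) :=
    contDiffOn_of_hasFDerivAt_flip Metric.isOpen_ball (hR.mono hrU) hP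
  have hP' : ∀ x ∈ Metric.ball x₀ r,
      HasFDerivAt P ((ContinuousLinearMap.compL ℝ V V V (P x)).comp (Γ x)) x :=
    fun x hx => (hP x hx).congr_fderiv rfl
  obtain ⟨X, hX⟩ := (convex_ball x₀ r).exists_forall_hasFDerivAt_of_fderiv_symmetric
    Metric.isOpen_ball (fun x hx => (hP' x hx).differentiableAt.differentiableWithinAt)
    (fun x hx a b => by
      rw [(hP' x hx).fderiv]
      simp [hsymm x (hrU hx) a b])
  have hXs : ContDiffOn ℝ ∞ X (Metric.ball x₀ r) := by
    rw [contDiffOn_infty_iff_fderiv_of_isOpen Metric.isOpen_ball]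
    exact ⟨fun x hx => (hX x hx).differentiableAt.differentiableWithinAt,
      hPs.congr fun x hx => (hX x hx).fderiv⟩
  refine ⟨Metric.ball x₀ r ∩ P ⁻¹' {Q | IsUnit Q}, X, P,
    hPs.continuousOn.isOpen_inter_preimage Metric.isOpen_ball Units.isOpen,
    ⟨Metric.mem_ball_self hr, ?_⟩, inter_subset_left.trans hrU, hXs.mono inter_subset_left,
    hPs.mono inter_subset_left, fun x hx => ⟨hx.2, hX x hx.1, hP' x hx.1⟩⟩
  rw [mem_preimage, hP₀]
  exact isUnit_one

/-- If `X` are flat coordinates and `P = dX`, then `φ(θ, u) = X(θ) + i P(θ) u` is a holomorphic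
chart of the tangent bundle: its differential maps a tangent vector with horizontal part `v` and
vertical part `w` to `P v + i P w`. Here `T z` is the splitting into the horizontal and vertical
parts, and `ι (v, w)` plays the role of `v + i w`. -/
theorem isIntegrableOn_of_flat (hU : IsOpen U) (hΓ : ContDiffOn ℝ ∞ Γ U)
    (hsymm : ∀ x ∈ U, ∀ a b, Γ x a b = Γ x b a)
    (hflat : ∀ x ∈ U, ∀ a b,
      fderiv ℝ Γ x a b + Γ x a ∘L Γ x b = fderiv ℝ Γ x b a + Γ x b ∘L Γ x a)
    {T : V × V → (V × V) ≃L[ℝ] V × V} (hT : ∀ z A, T z A = (A.1, A.2 + Γ z.1 A.1 z.2))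
    {J : V × V → (V × V) →L[ℝ] V × V} (hJ : ∀ z A, T z (J z A) = (-(T z A).2, (T z A).1))
    {m : ℕ} (ι : (V × V) ≃L[ℝ] (Fin m → ℂ)) (hι : ∀ v w, ι (-w, v) = Complex.I • ι (v, w)) :
    StatKahler.IsIntegrableOn (U ×ˢ univ) J := by
  rintro z₀ ⟨hz₀, -⟩
  obtain ⟨O, X, P, hO, hz₀O, hOU, hX, hP, hXP⟩ := exists_flat_coordinates hU hΓ hsymm hflat hz₀
  let φ : V × V → (Fin m → ℂ) := fun z => ι (X z.1, P z.1 z.2)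
  have hO' : IsOpen (O ×ˢ (univ : Set V)) := hO.prod isOpen_univ
  have hφs : ContDiffOn ℝ ∞ φ (O ×ˢ univ) := by
    have hfst : MapsTo (Prod.fst : V × V → V) (O ×ˢ univ) O := fun z hz => hz.1
    exact ι.contDiff.comp_contDiffOn ((hX.comp contDiff_fst.contDiffOn hfst).prodMk
      ((hP.comp contDiff_fst.contDiffOn hfst).clm_apply contDiff_snd.contDiffOn))
  have hφd : ∀ z ∈ O ×ˢ (univ : Set V), ∃ φ' : (V × V) ≃L[ℝ] (Fin m → ℂ),
      HasFDerivAt φ (φ' : (V × V) →L[ℝ] (Fin m → ℂ)) z ∧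
        ∀ A, φ' A = ι (P z.1 (T z A).1, P z.1 (T z A).2) := by
    intro z hz
    obtain ⟨⟨u, hu⟩, hXz, hPz⟩ := hXP z.1 hz.1
    let Q : V ≃L[ℝ] V := ContinuousLinearEquiv.unitsEquiv ℝ V u
    have hQ : ∀ a, Q a = P z.1 a := fun a => by rw [← hu]; rfl
    refine ⟨((T z).trans (Q.prodCongr Q)).trans ι, ?_, fun A => by simp [hQ]⟩
    have h1 := hXz.comp z (hasFDerivAt_fst (𝕜 := ℝ) (p := z))
    have h2 := (hPz.comp z (hasFDerivAt_fst (𝕜 := ℝ) (p := z))).clm_apply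
      (hasFDerivAt_snd (𝕜 := ℝ) (p := z))
    refine (ι.hasFDerivAt.comp z (h1.prodMk h2)).congr_fderiv
      (ContinuousLinearMap.ext fun A => ?_)
    simp [hQ, hT]
  have hz₀' : z₀ ∈ O ×ˢ (univ : Set V) := ⟨hz₀O, mem_univ _⟩
  obtain ⟨φ', hφ', -⟩ := hφd z₀ hz₀'
  have hc : ContDiffAt ℝ ∞ φ z₀ := hφs.contDiffAt (hO'.mem_nhds hz₀')
  let e := (hc.toOpenPartialHomeomorph φ hφ' (by simp)).restrOpen (O ×ˢ univ) hO'
  have he : (e : V × V → (Fin m → ℂ)) = φ := rfl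
  have hes : ∀ z ∈ e.source, z ∈ O ×ˢ (univ : Set V) := fun z hz => hz.2
  refine ⟨m, e, ⟨hc.mem_toOpenPartialHomeomorph_source hφ' (by simp), hz₀'⟩,
    fun z hz => ⟨hOU (hes z hz).1, mem_univ _⟩, hφs.mono hes, fun q hq => ?_, fun z hz A => ?_⟩
  · have hq' := hes _ (e.map_target hq)
    obtain ⟨ψ, hψ, -⟩ := hφd _ hq'
    exact (e.contDiffAt_symm hq hψ (hφs.contDiffAt (hO'.mem_nhds hq'))).contDiffWithinAt
  · obtain ⟨ψ, hψ, hψA⟩ := hφd z (hes z hz)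
    rw [he, hψ.fderiv]
    simp only [ContinuousLinearEquiv.coe_coe, hψA, hJ, map_neg, hι]

end FlatCoordinates

/-! ### The Christoffel map of a connection -/

section Christoffel

variable {n : ℕ} {Θ : Set (Param n)} (D : AffineConnection Θ)

theorem nabla_const (hΘ : IsOpen Θ) (a b : Param n) {θ : Param n} (hθ : θ ∈ Θ) :
    D.nabla (fun _ => a) (fun _ => b) θ = christoffel D θ a b := by
  rw [connector_spec D hΘ _ _ contDiffOn_const contDiffOn_const θ hθ]
  simp [connector]

theorem contDiffOn_christoffel : ContDiffOn ℝ ∞ (christoffel D) Θ := by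
  unfold christoffel
  refine ContDiffOn.sum fun i _ => ContDiffOn.sum fun j _ => ?_
  have hN := D.smooth (fun _ => basisVec i) (fun _ => basisVec j) contDiffOn_const contDiffOn_const
  exact (ContinuousLinearMap.smulRightL ℝ (Param n) (Param n →L[ℝ] Param n)
      (EuclideanSpace.proj i)).contDiff.comp_contDiffOn
    ((ContinuousLinearMap.smulRightL ℝ (Param n) (Param n)
      (EuclideanSpace.proj j)).contDiff.comp_contDiffOn hN)

theorem hasFDerivAt_christoffel (hΘ : IsOpen Θ) {θ : Param n} (hθ : θ ∈ Θ) :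
    HasFDerivAt (christoffel D) (fderiv ℝ (christoffel D) θ) θ :=
  (((contDiffOn_christoffel D).contDiffAt (hΘ.mem_nhds hθ)).differentiableAt
    (by simp)).hasFDerivAt

variable {D}

theorem christoffel_symm (hΘ : IsOpen Θ) (hD : D.IsTorsionFree) {θ : Param n} (hθ : θ ∈ Θ)
    (a b : Param n) : christoffel D θ a b = christoffel D θ b a := by
  have := hD (fun _ => a) (fun _ => b) contDiffOn_const contDiffOn_const θ hθ
  simp only [AffineConnection.torsion, nabla_const D hΘ _ _ hθ, VectorField.lieBracket,
    fderiv_fun_const, Pi.zero_apply, zero_apply, sub_zero] at this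
  exact sub_eq_zero.1 this

theorem nabla_nabla_const (hΘ : IsOpen Θ) (a b c : Param n) {θ : Param n} (hθ : θ ∈ Θ) :
    D.nabla (fun _ => a) (D.nabla (fun _ => b) (fun _ => c)) θ
      = fderiv ℝ (christoffel D) θ a b c + christoffel D θ a (christoffel D θ b c) := by
  rw [connector_spec D hΘ _ _ contDiffOn_const (D.smooth _ _ contDiffOn_const contDiffOn_const)
    θ hθ]
  have hev : D.nabla (fun _ => b) (fun _ => c) =ᶠ[nhds θ] fun η => christoffel D η b c := by
    filter_upwards [hΘ.mem_nhds hθ] with η hη using nabla_const D hΘ b c hη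
  have hd := ((hasFDerivAt_christoffel D hΘ hθ).clm_apply (hasFDerivAt_const b θ)).clm_apply
    (hasFDerivAt_const c θ)
  rw [hev.fderiv_eq, hd.fderiv, nabla_const D hΘ b c hθ]
  simp [connector]

/-- The vanishing of the curvature, evaluated on constant vector fields. -/
theorem christoffel_flat (hΘ : IsOpen Θ) (hD : D.IsFlat) {θ : Param n} (hθ : θ ∈ Θ)
    (a b : Param n) :
    fderiv ℝ (christoffel D) θ a b + christoffel D θ a ∘L christoffel D θ b
      = fderiv ℝ (christoffel D) θ b a + christoffel D θ b ∘L christoffel D θ a := by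
  refine ContinuousLinearMap.ext fun c => ?_
  have := hD (fun _ => a) (fun _ => b) (fun _ => c) contDiffOn_const contDiffOn_const
    contDiffOn_const θ hθ
  have hbr : VectorField.lieBracket ℝ (fun _ : Param n => a) (fun _ => b) = fun _ => 0 := by
    funext η
    simp [VectorField.lieBracket]
  rw [AffineConnection.curvature, nabla_nabla_const hΘ a b c hθ, nabla_nabla_const hΘ b a c hθ,
    hbr, nabla_const D hΘ 0 c hθ, map_zero, zero_apply, sub_zero] at this
  exact sub_eq_zero.1 this

variable {h : Param n → Param n →L[ℝ] Param n →L[ℝ] ℝ}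

theorem hasFDerivAt_metric (hΘ : IsOpen Θ) (hh : ContDiffOn ℝ ∞ h Θ) {θ : Param n} (hθ : θ ∈ Θ) :
    HasFDerivAt h (fderiv ℝ h θ) θ :=
  ((hh.contDiffAt (hΘ.mem_nhds hθ)).differentiableAt (by simp)).hasFDerivAt

theorem fderiv_metric_apply (hΘ : IsOpen Θ) (hh : ContDiffOn ℝ ∞ h Θ) {θ : Param n} (hθ : θ ∈ Θ)
    (a b c : Param n) : fderiv ℝ (fun η => h η b c) θ a = fderiv ℝ h θ a b c := by
  rw [(((hasFDerivAt_metric hΘ hh hθ).clm_apply (hasFDerivAt_const b θ)).clm_apply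
    (hasFDerivAt_const c θ)).fderiv]
  simp

theorem fderiv_metric_symm (hΘ : IsOpen Θ) (hh : IsRiemannianMetricOn Θ h) {θ : Param n}
    (hθ : θ ∈ Θ) (a b c : Param n) : fderiv ℝ h θ a b c = fderiv ℝ h θ a c b := by
  have hev : (fun η => h η b c) =ᶠ[nhds θ] fun η => h η c b := by
    filter_upwards [hΘ.mem_nhds hθ] with η hη using hh.symm η hη b c
  rw [← fderiv_metric_apply hΘ hh.smooth hθ, ← fderiv_metric_apply hΘ hh.smooth hθ, hev.fderiv_eq]

/-- The Codazzi equation in coordinates. -/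
theorem christoffel_codazzi (hΘ : IsOpen Θ) (hS : IsStatisticalManifold Θ h D) {θ : Param n}
    (hθ : θ ∈ Θ) (a b c : Param n) :
    fderiv ℝ h θ a b c - h θ b (christoffel D θ a c)
      = fderiv ℝ h θ b a c - h θ a (christoffel D θ b c) := by
  have key := hS.symm_left (fun _ => a) (fun _ => b) (fun _ => c) contDiffOn_const
    contDiffOn_const contDiffOn_const θ hθ
  simp only [AffineConnection.nablaMetric, nabla_const D hΘ _ _ hθ,
    fderiv_metric_apply hΘ hS.metric.smooth hθ] at key
  rw [christoffel_symm hΘ hS.torsionFree hθ b a] at key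
  linarith

end Christoffel

/-! ### The almost Hermitian structure -/

section Hermitian

variable {n : ℕ} {Θ : Set (Param n)} (D : AffineConnection Θ)
  (h : Param n → Param n →L[ℝ] Param n →L[ℝ] ℝ)

theorem connector_apply (z A : Param n × Param n) :
    connector D z A = A.2 + christoffel D z.1 A.1 z.2 := by
  simp [connector]

theorem triple_apply (z A : Param n × Param n) :
    triple D z A = (A.1, connector D z A) := rfl

theorem triple_dombrowskiJ (z A : Param n × Param n) :
    triple D z (dombrowskiJ D z A) = (-(triple D z A).2, (triple D z A).1) := by
  simp [dombrowskiJ]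

theorem dombrowskiMetric_apply (z A B : Param n × Param n) :
    dombrowskiMetric D h z A B
      = h z.1 A.1 B.1 + h z.1 (connector D z A) (connector D z B) := by
  simp [dombrowskiMetric]

theorem dombrowskiForm_apply (z A B : Param n × Param n) :
    dombrowskiForm D h z A B
      = h z.1 A.1 (connector D z B) - h z.1 (connector D z A) B.1 := by
  simp [dombrowskiForm]

theorem dombrowskiJ_fst (z A : Param n × Param n) :
    (dombrowskiJ D z A).1 = -connector D z A :=
  congrArg Prod.fst (triple_dombrowskiJ D z A)

theorem connector_dombrowskiJ (z A : Param n × Param n) :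
    connector D z (dombrowskiJ D z A) = A.1 :=
  congrArg Prod.snd (triple_dombrowskiJ D z A)

theorem contDiffOn_christoffel_flip : ContDiffOn ℝ ∞
    (fun z : Param n × Param n => ((christoffel D z.1).flip z.2).comp
      (ContinuousLinearMap.fst ℝ (Param n) (Param n))) (tangentBundle Θ) := by
  have h1 : ContDiffOn ℝ ∞ (fun z : Param n × Param n => (christoffel D z.1).flip)
      (tangentBundle Θ) :=
    (ContinuousLinearMap.flipₗᵢ ℝ (Param n) (Param n) (Param n)).contDiff.comp_contDiffOn
      ((contDiffOn_christoffel D).comp contDiff_fst.contDiffOn fun z hz => hz.1)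
  exact (h1.clm_apply contDiff_snd.contDiffOn).clm_comp contDiffOn_const

theorem contDiffOn_connector : ContDiffOn ℝ ∞ (connector D) (tangentBundle Θ) :=
  contDiffOn_const.add (contDiffOn_christoffel_flip D)

theorem contDiffOn_dombrowskiJ : ContDiffOn ℝ ∞ (dombrowskiJ D) (tangentBundle Θ) := by
  have hprod : ∀ {f g : Param n × Param n → (Param n × Param n) →L[ℝ] Param n},
      ContDiffOn ℝ ∞ f (tangentBundle Θ) → ContDiffOn ℝ ∞ g (tangentBundle Θ) →
      ContDiffOn ℝ ∞ (fun z => (f z).prod (g z)) (tangentBundle Θ) := fun hf hg =>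
    (ContinuousLinearMap.prodₗᵢ (𝕜 := ℝ) (E := Param n × Param n) (F := Param n)
      (G := Param n) ℝ).contDiff.comp_contDiffOn (hf.prodMk hg)
  exact (hprod contDiffOn_const (contDiffOn_const.sub (contDiffOn_christoffel_flip D))).clm_comp
    (contDiffOn_const.clm_comp (hprod contDiffOn_const (contDiffOn_connector D)))

variable {h}

theorem contDiffOn_bilinearComp {E : Type*} [NormedAddCommGroup E] [NormedSpace ℝ E]
    {s : Set E} {B : E → Param n →L[ℝ] Param n →L[ℝ] ℝ} {f g : E → E →L[ℝ] Param n}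
    (hB : ContDiffOn ℝ ∞ B s) (hf : ContDiffOn ℝ ∞ f s) (hg : ContDiffOn ℝ ∞ g s) :
    ContDiffOn ℝ ∞ (fun x => (B x).bilinearComp (f x) (g x)) s := by
  have h1 : ContDiffOn ℝ ∞ (fun x => ((B x).comp (f x)).flip) s :=
    (ContinuousLinearMap.flipₗᵢ ℝ E (Param n) ℝ).contDiff.comp_contDiffOn (hB.clm_comp hf)
  exact (ContinuousLinearMap.flipₗᵢ ℝ E E ℝ).contDiff.comp_contDiffOn (h1.clm_comp hg)

theorem contDiffOn_comp_fst (hh : ContDiffOn ℝ ∞ h Θ) :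
    ContDiffOn ℝ ∞ (fun z : Param n × Param n => h z.1) (tangentBundle Θ) :=
  hh.comp contDiff_fst.contDiffOn fun _ hz => hz.1

theorem isAlmostHermitianOn_dombrowski (hΘ : IsOpen Θ) (hh : IsRiemannianMetricOn Θ h) :
    IsAlmostHermitianOn (tangentBundle Θ) (dombrowskiMetric D h) (dombrowskiJ D)
      (dombrowskiForm D h) where
  isOpen := hΘ.prod isOpen_univ
  metric :=
    { smooth := (contDiffOn_bilinearComp (contDiffOn_comp_fst hh.smooth) contDiffOn_const
          contDiffOn_const).add
        (contDiffOn_bilinearComp (contDiffOn_comp_fst hh.smooth) (contDiffOn_connector D)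
          (contDiffOn_connector D))
      symm := fun z hz A B => by
        rw [dombrowskiMetric_apply, dombrowskiMetric_apply, hh.symm _ hz.1 A.1,
          hh.symm _ hz.1 (connector D z A)]
      pos := fun z hz A hA => by
        rw [dombrowskiMetric_apply]
        have hnn : ∀ a, 0 ≤ h z.1 a a := fun a => by
          by_cases ha : a = 0
          · simp [ha]
          · exact (hh.pos _ hz.1 a ha).le
        by_cases ha : A.1 = 0
        · have hA2 : connector D z A ≠ 0 := fun h0 =>
            hA ((triple D z).map_eq_zero_iff.1 (by rw [triple_apply, ha, h0, Prod.mk_zero_zero]))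
          exact add_pos_of_nonneg_of_pos (hnn _) (hh.pos _ hz.1 _ hA2)
        · exact add_pos_of_pos_of_nonneg (hh.pos _ hz.1 _ ha) (hnn _) }
  smooth_J := contDiffOn_dombrowskiJ D
  J_sq := fun z _ A => (triple D z).injective <| by
    rw [triple_dombrowskiJ, triple_dombrowskiJ, map_neg]
    rfl
  invariant := fun z _ A B => by
    simp [dombrowskiMetric_apply, dombrowskiJ_fst, connector_dombrowskiJ, add_comm]
  fundamental := fun z _ A B => by
    rw [dombrowskiForm_apply, dombrowskiMetric_apply, dombrowskiJ_fst, connector_dombrowskiJ,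
      map_neg, neg_apply]
    ring
  smooth_form := (contDiffOn_bilinearComp (contDiffOn_comp_fst hh.smooth) contDiffOn_const
      (contDiffOn_connector D)).sub
    (contDiffOn_bilinearComp (contDiffOn_comp_fst hh.smooth) (contDiffOn_connector D)
      contDiffOn_const)
  skew := fun z hz A B => by
    rw [dombrowskiForm_apply, dombrowskiForm_apply, hh.symm _ hz.1 A.1,
      hh.symm _ hz.1 (connector D z A)]
    ring

end Hermitian

/-! ### The fundamental form is exact -/

section Closed

/-- The exterior derivative of a 1-form is the alternation of its derivative. -/
theorem extDeriv_ofSubsingleton {V : Type*} [NormedAddCommGroup V] [NormedSpace ℝ V]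
    {α : V → V →L[ℝ] ℝ} {x : V} (hα : DifferentiableAt ℝ α x) :
    extDeriv (fun y => ContinuousAlternatingMap.ofSubsingletonLIE (𝕜 := ℝ) (E := V) (F := ℝ)
      (0 : Fin 1) (α y)) x = (2 : ℝ) • twoForm (fderiv ℝ α x) := by
  rw [extDeriv, twoForm, smul_smul]
  norm_num
  congr 1
  exact ((ContinuousAlternatingMap.ofSubsingletonLIE (𝕜 := ℝ) (E := V) (F := ℝ)
    (0 : Fin 1)).toContinuousLinearEquiv.hasFDerivAt.comp x hα.hasFDerivAt).fderiv

variable {n : ℕ} {Θ : Set (Param n)} {D : AffineConnection Θ}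
  {h : Param n → Param n →L[ℝ] Param n →L[ℝ] ℝ}

/-- The 1-form `(a, b) ↦ h_θ(u, a)` at the point `(θ, u)` of the tangent bundle: the pullback of the
canonical 1-form of the cotangent bundle by the isomorphism induced by `h`. -/
noncomputable def canonicalOneForm (h : Param n → Param n →L[ℝ] Param n →L[ℝ] ℝ)
    (z : Param n × Param n) : (Param n × Param n) →L[ℝ] ℝ :=
  (h z.1 z.2).comp (ContinuousLinearMap.fst ℝ (Param n) (Param n))

theorem contDiffOn_canonicalOneForm (hh : ContDiffOn ℝ ∞ h Θ) :
    ContDiffOn ℝ ∞ (canonicalOneForm h) (tangentBundle Θ) :=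
  ((contDiffOn_comp_fst hh).clm_apply contDiff_snd.contDiffOn).clm_comp contDiffOn_const

theorem fderiv_canonicalOneForm (hΘ : IsOpen Θ) (hh : ContDiffOn ℝ ∞ h Θ)
    {z : Param n × Param n} (hz : z ∈ tangentBundle Θ) (A B : Param n × Param n) :
    fderiv ℝ (canonicalOneForm h) z A B = fderiv ℝ h z.1 A.1 z.2 B.1 + h z.1 A.2 B.1 := by
  have h1 := ((hasFDerivAt_metric hΘ hh hz.1).comp z (hasFDerivAt_fst (𝕜 := ℝ) (p := z))).clm_apply
    (hasFDerivAt_snd (𝕜 := ℝ) (p := z))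
  have h2 := h1.clm_comp
    (hasFDerivAt_const (ContinuousLinearMap.fst ℝ (Param n) (Param n)) z)
  rw [show fderiv ℝ (canonicalOneForm h) z = _ from h2.fderiv]
  simp [add_comm]

/-- By the Codazzi equation, the fundamental form is minus the exterior derivative of the canonical
1-form. -/
theorem twoForm_dombrowskiForm (hΘ : IsOpen Θ) (hS : IsStatisticalManifold Θ h D)
    {z : Param n × Param n} (hz : z ∈ tangentBundle Θ) :
    twoForm (dombrowskiForm D h z) = (-2 : ℝ) • twoForm (fderiv ℝ (canonicalOneForm h) z) := by
  ext v
  have hv : v = ![v 0, v 1] := by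
    funext i
    fin_cases i <;> rfl
  rw [hv, twoForm_apply_of_skew _
    ((isAlmostHermitianOn_dombrowski D hΘ hS.metric).skew z hz),
    ContinuousAlternatingMap.smul_apply, twoForm_apply,
    fderiv_canonicalOneForm hΘ hS.metric.smooth hz, fderiv_canonicalOneForm hΘ hS.metric.smooth hz,
    dombrowskiForm_apply, connector_apply, connector_apply]
  generalize v 0 = A
  generalize v 1 = B
  have hc := christoffel_codazzi hΘ hS hz.1 A.1 B.1 z.2
  have hs := fderiv_metric_symm hΘ hS.metric hz.1
  rw [map_add, map_add, add_apply, hs A.1, hs B.1,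
    hS.metric.symm _ hz.1 A.1 B.2, hS.metric.symm _ hz.1 (christoffel D z.1 A.1 z.2), smul_eq_mul]
  linarith

theorem isClosedOn_dombrowskiForm (hΘ : IsOpen Θ) (hS : IsStatisticalManifold Θ h D) :
    IsClosedOn (tangentBundle Θ) (dombrowskiForm D h) := by
  intro z hz
  have hU : IsOpen (tangentBundle Θ) := hΘ.prod isOpen_univ
  let ℓ := ContinuousAlternatingMap.ofSubsingletonLIE (𝕜 := ℝ) (E := Param n × Param n) (F := ℝ)
    (0 : Fin 1)
  have hα := contDiffOn_canonicalOneForm (Θ := Θ) hS.metric.smooth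
  have hev : (fun y => twoForm (dombrowskiForm D h y)) =ᶠ[nhds z]
      (-1 : ℝ) • extDeriv (fun y => ℓ (canonicalOneForm h y)) := by
    filter_upwards [hU.mem_nhds hz] with y hy
    rw [twoForm_dombrowskiForm hΘ hS hy, Pi.smul_apply, extDeriv_ofSubsingleton
      ((hα.contDiffAt (hU.mem_nhds hy)).differentiableAt (by simp)), smul_smul]
    norm_num
  have hℓ : ContDiffAt ℝ ∞ (fun y => ℓ (canonicalOneForm h y)) z :=
    ℓ.contDiff.contDiffAt.comp z (hα.contDiffAt (hU.mem_nhds hz))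
  rw [hev.extDeriv_eq, extDeriv_smul, extDeriv_extDeriv_apply hℓ
    (by simpa using WithTop.coe_le_coe.2 (le_top : (2 : ℕ∞) ≤ ⊤)), smul_zero]

end Closed

/-! ### The complex structure -/

section Complex

variable {n : ℕ}

/-- The identification `(v, w) ↦ v + i w` of `ℝⁿ × ℝⁿ` with `ℂⁿ`. -/
noncomputable def complexEquiv (n : ℕ) : (Param n × Param n) ≃L[ℝ] (Fin n → ℂ) :=
  LinearEquiv.toContinuousLinearEquiv
    { toFun := fun z k => ⟨z.1 k, z.2 k⟩
      invFun := fun f => (WithLp.toLp 2 fun k => (f k).re, WithLp.toLp 2 fun k => (f k).im)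
      map_add' := fun _ _ => rfl
      map_smul' := fun c z => by
        ext k
        apply Complex.ext <;> simp
      left_inv := fun _ => rfl
      right_inv := fun _ => rfl }

theorem complexEquiv_apply (z : Param n × Param n) (k : Fin n) :
    complexEquiv n z k = ⟨z.1 k, z.2 k⟩ := rfl

theorem complexEquiv_rotate (v w : Param n) :
    complexEquiv n (-w, v) = Complex.I • complexEquiv n (v, w) := by
  ext k
  apply Complex.ext <;> simp [complexEquiv_apply]

theorem isIntegrableOn_dombrowskiJ {Θ : Set (Param n)} {D : AffineConnection Θ} (hΘ : IsOpen Θ)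
    (htor : D.IsTorsionFree) (hflat : D.IsFlat) :
    IsIntegrableOn (tangentBundle Θ) (dombrowskiJ D) :=
  isIntegrableOn_of_flat hΘ (contDiffOn_christoffel D)
    (fun _ hθ => christoffel_symm hΘ htor hθ) (fun _ hθ => christoffel_flat hΘ hflat hθ)
    (fun z A => by rw [triple_apply, connector_apply]) (triple_dombrowskiJ D)
    (complexEquiv n) complexEquiv_rotate

end Complex

end StatKahler

open StatKahler in
theorem proposition3p1 {n : ℕ} {𝒳 : Type*} [MeasurableSpace 𝒳] (μ : Measure 𝒳)
    (Θ : Set (Param n)) (p : Param n → 𝒳 → ℝ) (hp : IsStatisticalModel Θ μ p)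
    (h : Param n → Param n →L[ℝ] Param n →L[ℝ] ℝ) (hF : IsFisherMetric Θ μ p h)
    (D : AffineConnection Θ) (hS : IsStatisticalManifold Θ h D) (hflat : D.IsFlat) :
    (∀ z ∈ tangentBundle Θ, ∀ v w v' w' : Param n,
      dombrowskiMetric D h z ((triple D z).symm (v, w)) ((triple D z).symm (v', w'))
          = h z.1 v v' + h z.1 w w' ∧
      dombrowskiForm D h z ((triple D z).symm (v, w)) ((triple D z).symm (v', w'))
          = h z.1 v w' - h z.1 w v' ∧
      dombrowskiJ D z ((triple D z).symm (v, w)) = (triple D z).symm (-w, v)) ∧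
    IsKahlerOn (tangentBundle Θ) (dombrowskiMetric D h) (dombrowskiJ D) (dombrowskiForm D h) := by
  refine ⟨fun z _ v w v' w' => ?_, isAlmostHermitianOn_dombrowski D hp.isOpen hS.metric,
    isIntegrableOn_dombrowskiJ hp.isOpen hS.torsionFree hflat,
    isClosedOn_dombrowskiForm hp.isOpen hS⟩
  have hsymm : ∀ v w : Param n, ((triple D z).symm (v, w)).1 = v ∧
      connector D z ((triple D z).symm (v, w)) = w := fun v w =>
    Prod.ext_iff.1 ((triple D z).apply_symm_apply (v, w))
  refine ⟨?_, ?_, ?_⟩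
  · rw [dombrowskiMetric_apply, (hsymm v w).1, (hsymm v w).2, (hsymm v' w').1, (hsymm v' w').2]
  · rw [dombrowskiForm_apply, (hsymm v w).1, (hsymm v w).2, (hsymm v' w').1, (hsymm v' w').2]
  · simp [dombrowskiJ]
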